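/- Let $\Omega$ be a quadratically closed field of characteristic $2$ (every monic quadratic polynomial over $\Omega$ has a root in $\Omega$), let $n = 2r$ with $r \ge 1$, and let the Borel subgroup $B \subset GL(n,\Omega)$ of upper triangular matrices act on quadratic forms $q$ in $x_1,\dots,x_n$ over $\Omega$ by $b\cdot x_t=\sum_{j} b_{t,j}x_j$. A quadratic form is in *normal form* if it can be written $q = q_1+\cdots+q_m$ ($m \ge 0$) with $q_t = \epsilon_t x_{i_t}^2+\delta_t x_{i_t}x_{j_t}$, where $\epsilon_t,\delta_t\in\{0,1\}$ are not both $0$; the sets $\{i_t,j_t\}$ are pairwise disjoint; $j_t=i_t$ if and only if $\delta_t=0$; $i_1<\cdots<i_m$ and $i_t\le j_t$ for all $t$; if $\epsilon_t=1$ and $\delta_t=0$, then $\epsilon_s=0$ for all $s>t$; and if $i_s<i_t<j_t<j_s$, then $\epsilon_s\epsilon_t=0$. The form $q$ is *non-degenerate* if no nonzero vector $v$ satisfies both $q(v)=0$ and $q(v+w)=q(v)+q(w)$ for all $w$. Its *$B$-rank* is $n-\dim \pi(B_q)$, where $B_q$ is the stabilizer of $q$ in $B$ and $\pi$ sends an upper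 triangular matrix to its diagonal part. The maximal $B$-rank for $n=2r$ is $2r$. For a non-degenerate normal form $q=q_1+\cdots+q_m$ of $B$-rank $2r$, a *connected component* of $q$ is a partial sum $q_s+\cdots+q_{e}$ with $e\ge s$ minimal such that each of its indices is larger than all indices occurring in $q_1,\dots,q_{s-1}$ and smaller than all indices occurring in $q_{e+1},\dots,q_m$. For integers $n,k$ let the Catalan triangle number $C(n,k)$ be $0$ unless $0\le k\le n$, and for $0\le k\le n$ let $$C(n,k)=\begin{cases}1 & n=k=0,\\ C(n-1,0) & k=0<n,\\ C(n,k-1)+C(n-1,k) & 0<k<n,\\ C(n,n-1) & k=n>0.\end{cases}$$ Then for every $r\ge1$ and every integer $f$, the number $b(2r,f)$ of non-degenerate quadratic normal forms in $2r$ variables over $\Omega$ of maximal $B$-rank $2r$ with exactly $f$ connected components is finite and equals $C(r-1,r-f)$. -/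

import Mathlib

/-- `Ω` is quadratically closed: every monic polynomial of degree two over `Ω` has a root in `Ω`,
i.e. `Ω` has no quadratic extension (this is the meaning of the term in every characteristic). -/
def IsQuadraticallyClosed (Ω : Type*) [Field Ω] : Prop :=
  ∀ a b : Ω, ∃ x : Ω, x ^ 2 + a * x + b = 0

/-- The inverse of an invertible upper triangular matrix is upper triangular. -/
theorem GL.inv_isUpperTriangular {n : ℕ} {Ω : Type*} [Field Ω] (g : GL (Fin n) Ω)
    (hg : (g : Matrix (Fin n) (Fin n) Ω).BlockTriangular id) :
    ((g⁻¹ : GL (Fin n) Ω) : Matrix (Fin n) (Fin n) Ω).BlockTriangular id := by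
  rw [Matrix.coe_units_inv]
  have : Invertible (g : Matrix (Fin n) (Fin n) Ω) := g.invertible
  exact Matrix.blockTriangular_inv_of_blockTriangular hg

/-- The Borel subgroup `B` of upper triangular matrices in `GL(n, Ω)`. -/
def borelSubgroup (n : ℕ) (Ω : Type*) [Field Ω] : Subgroup (GL (Fin n) Ω) where
  carrier := {g | (g : Matrix (Fin n) (Fin n) Ω).BlockTriangular id}
  one_mem' := by
    simpa using (Matrix.blockTriangular_one : (1 : Matrix (Fin n) (Fin n) Ω).BlockTriangular id)
  mul_mem' := by
    intro a b ha hb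
    simpa using Matrix.BlockTriangular.mul ha hb
  inv_mem' := by
    intro a ha
    exact GL.inv_isUpperTriangular a ha

/-- The action of `g ∈ GL(n, Ω)` on quadratic forms in `n` variables by the linear substitution
`x_t ↦ ∑ j, g_{t,j} x_j`, that is, `(g · q)(v) = q (g v)` for column vectors `v`. -/
noncomputable def formAction {n : ℕ} {Ω : Type*} [Field Ω] (g : GL (Fin n) Ω)
    (q : QuadraticForm Ω (Fin n → Ω)) : QuadraticForm Ω (Fin n → Ω) :=
  q.comp (Matrix.toLin' (g : Matrix (Fin n) (Fin n) Ω))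

/-- The stabilizer `B_q` of `q` in the Borel subgroup. -/
def borelStabilizer {n : ℕ} {Ω : Type*} [Field Ω] (q : QuadraticForm Ω (Fin n → Ω)) :
    Set (GL (Fin n) Ω) :=
  {b | b ∈ borelSubgroup n Ω ∧ formAction b q = q}

/-- The image `π(B_q)` of the stabilizer under the projection `π : B → T` onto the maximal torus
of diagonal matrices; a diagonal matrix is recorded by its vector of diagonal entries. -/
def torusImage {n : ℕ} {Ω : Type*} [Field Ω] (q : QuadraticForm Ω (Fin n → Ω)) :
    Set (Fin n → Ω) :=
  (fun b : GL (Fin n) Ω => (b : Matrix (Fin n) (Fin n) Ω).diag) '' borelStabilizer q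

/-- The dimension of a subset `S` of affine `n`-space `Ω ^ n`: the Krull dimension of the ring
`Ω[x_1, …, x_n] / I(S)` of polynomial functions on `S`. -/
noncomputable def affineDim {n : ℕ} {Ω : Type*} [Field Ω] (S : Set (Fin n → Ω)) : WithBot ℕ∞ :=
  ringKrullDim (MvPolynomial (Fin n) Ω ⧸ MvPolynomial.vanishingIdeal Ω S)

/-- The `B`-rank of (the `B`-orbit of) `q`, namely `n - dim π(B_q)`. -/
noncomputable def bRank {n : ℕ} {Ω : Type*} [Field Ω] (q : QuadraticForm Ω (Fin n → Ω)) : ℕ :=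
  n - ((affineDim (torusImage q)).unbotD 0).toNat

/-- No default value enters the definition of the `B`-rank: `B-rank + dim π(B_q) = n`. -/
theorem bRank_add_affineDim {n : ℕ} {Ω : Type*} [Field Ω] (q : QuadraticForm Ω (Fin n → Ω)) :
    (bRank q : WithBot ℕ∞) + affineDim (torusImage q) = (n : WithBot ℕ∞) := by
  have hle : affineDim (torusImage q) ≤ (n : WithBot ℕ∞) := by
    refine (ringKrullDim_quotient_le _).trans ?_
    rw [MvPolynomial.ringKrullDim_of_isNoetherianRing]
    simp
  have hmem : (1 : Fin n → Ω) ∈ torusImage q := by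
    refine ⟨1, ⟨one_mem _, ?_⟩, ?_⟩
    · ext v
      simp [formAction]
    · ext i
      simp
  have hne : MvPolynomial.vanishingIdeal Ω (torusImage q) ≠ ⊤ := by
    intro h
    have h1 : (1 : MvPolynomial (Fin n) Ω) ∈ MvPolynomial.vanishingIdeal Ω (torusImage q) := by
      rw [h]; trivial
    have := h1 _ hmem
    simp at this
  have : Nontrivial (MvPolynomial (Fin n) Ω ⧸ MvPolynomial.vanishingIdeal Ω (torusImage q)) :=
    Ideal.Quotient.nontrivial_iff.mpr hne
  have hbot : affineDim (torusImage q) ≠ ⊥ := by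
    intro h
    have h0 := ringKrullDim_nonneg_of_nontrivial
      (R := MvPolynomial (Fin n) Ω ⧸ MvPolynomial.vanishingIdeal Ω (torusImage q))
    unfold affineDim at h
    rw [h] at h0
    simp at h0
  unfold bRank
  generalize affineDim (torusImage q) = d at hle hbot
  induction d with
  | bot => exact absurd rfl hbot
  | coe d =>
    have hd : d ≤ (n : ℕ∞) := by exact_mod_cast hle
    obtain ⟨m, rfl⟩ := ENat.ne_top_iff_exists.mp (ne_top_of_le_ne_top (ENat.natCast_ne_top n) hd)
    have hm : m ≤ n := by exact_mod_cast hd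
    simp only [WithBot.unbotD_coe, ENat.toNat_natCast]
    have h : ((n - m + m : ℕ) : WithBot ℕ∞) = (n : WithBot ℕ∞) := by rw [Nat.sub_add_cancel hm]
    rw [Nat.cast_add] at h
    exact h

/-- The combinatorial data of a quadratic form in normal form in `n` variables,
`q = q_1 + ⋯ + q_m` with `q_t = ε_t x_{i_t}^2 + δ_t x_{i_t} x_{j_t}`. -/
structure NormalDatum (n : ℕ) where
  /-- the number of normal components -/
  m : ℕ
  i : Fin m → Fin n
  j : Fin m → Fin n
  ε : Fin m → Bool
  δ : Fin m → Bool
  /-- `(ε_t, δ_t) ≠ (0, 0)` -/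
  ne_zero : ∀ t, ε t = true ∨ δ t = true
  /-- the sets `{i_t, j_t}` are pairwise disjoint -/
  disjoint : ∀ s t, s ≠ t → Disjoint ({i s, j s} : Set (Fin n)) {i t, j t}
  eq_iff : ∀ t, j t = i t ↔ δ t = false
  i_strictMono : StrictMono i
  i_le_j : ∀ t, i t ≤ j t
  /-- condition (C1) -/
  square_last : ∀ t, ε t = true → δ t = false → ∀ s, t < s → ε s = false
  /-- condition (C2) -/
  nested : ∀ s t, s ≠ t → i s < i t → i t < j t → j t < j s → ¬ (ε s = true ∧ ε t = true)

namespace NormalDatum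

variable {n : ℕ}

/-- The normal component `q_t = ε_t x_{i_t}^2 + δ_t x_{i_t} x_{j_t}`. -/
noncomputable def component (D : NormalDatum n) (Ω : Type*) [Field Ω] (t : Fin D.m) :
    QuadraticForm Ω (Fin n → Ω) :=
  (if D.ε t = true then
      QuadraticMap.linMulLin (LinearMap.proj (D.i t)) (LinearMap.proj (D.i t)) else 0) +
    (if D.δ t = true then
      QuadraticMap.linMulLin (LinearMap.proj (D.i t)) (LinearMap.proj (D.j t)) else 0)

/-- The quadratic form `q = q_1 + ⋯ + q_m`. -/
noncomputable def toForm (D : NormalDatum n) (Ω : Type*) [Field Ω] :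
    QuadraticForm Ω (Fin n → Ω) :=
  ∑ t, D.component Ω t

/-- `ind(q_t)`: the indices of the variables occurring in `q_t`. -/
def ind (D : NormalDatum n) (t : Fin D.m) : Set (Fin n) := {D.i t, D.j t}

/-- Every index of `q' = q_s + ⋯ + q_e` is larger than all the indices of `q_1 + ⋯ + q_{s-1}`
and smaller than all the indices of `q_{e+1} + ⋯ + q_m`. -/
def Separated (D : NormalDatum n) (s e : Fin D.m) : Prop :=
  ∀ t, s ≤ t → t ≤ e → ∀ a ∈ D.ind t,
    (∀ u, u < s → ∀ c ∈ D.ind u, c < a) ∧ (∀ u, e < u → ∀ c ∈ D.ind u, a < c)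

/-- `q_s + ⋯ + q_e` is a connected component of `q` (for `q` without a pure square as a normal
component): it is separated from the rest, and `e ≥ s` is minimal with this property. -/
def IsConnectedComponent (D : NormalDatum n) (s e : Fin D.m) : Prop :=
  s ≤ e ∧ D.Separated s e ∧ ∀ e', s ≤ e' → e' < e → ¬ D.Separated s e'

/-- The number of connected components. -/
noncomputable def numComponents (D : NormalDatum n) : ℕ :=
  {p : Fin D.m × Fin D.m | D.IsConnectedComponent p.1 p.2}.ncard

end NormalDatum

/-- The set of non-degenerate quadratic normal forms in `2 r` variables over `Ω` which are of
maximal `B`-rank `2 r` and have `f` connected components. Non-degenerate means that no nonzero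
vector `v` satisfies both `q v = 0` and `q (v + w) = q v + q w` for all `w`. -/
def maximalNormalForms (Ω : Type*) [Field Ω] (r : ℕ) (f : ℤ) :
    Set (QuadraticForm Ω (Fin (2 * r) → Ω)) :=
  {q | q.radical = ⊥ ∧ bRank q = 2 * r ∧
    ∃ D : NormalDatum (2 * r), D.toForm Ω = q ∧ (D.numComponents : ℤ) = f}

/-- The Catalan triangle for indices `n, k ≥ 0`; it vanishes for `k > n`. -/
def catalanTriangleNat : ℕ → ℕ → ℕ
  | 0, 0 => 1
  | 0, _ + 1 => 0
  | n + 1, 0 => catalanTriangleNat n 0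
  | n + 1, k + 1 =>
    if k + 1 < n + 1 then catalanTriangleNat (n + 1) k + catalanTriangleNat n (k + 1)
    else if k = n then catalanTriangleNat (n + 1) k
    else 0

/-- The Catalan triangle number `C(n, k)` for integers `n` and `k`; it vanishes unless
`0 ≤ k ≤ n`. -/
def catalanTriangle (n k : ℤ) : ℕ :=
  if 0 ≤ k ∧ k ≤ n then catalanTriangleNat n.toNat k.toNat else 0

/-!
Write a normal form as a set of pairs `(i_t, j_t)` with marks `ε_t, δ_t`. In an even number `2r` of
variables a non-degenerate one has all `δ_t = 1` and uses every variable: an unused variable spans a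
radical line, and there is room for at most one pure square, which parity excludes. So the pairs
form a perfect matching of the indices (`NormalDatum.isPerfect_of_radical_eq_bot`), and conversely
such a form is non-degenerate.

For a perfect matching the `B`-rank is `2r` if and only if all `ε_t = 1`
(`NormalDatum.IsPerfect.bRank_eq_iff`). If `ε_t = 0`, scaling `x_{i_t}` by `c` and `x_{j_t}` by
`c⁻¹` fixes the form, so the `i_t`-th coordinate takes infinitely many values on `π(B_q)`, which a
set of dimension zero does not allow. If all `ε_t = 1`, the condition on nested pairs says that no
pairs are nested. An element `g` of the stabilizer preserves the polar form, so `g⁻¹` is its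
adjoint; since both are upper triangular and the matching has no nesting, each `e_{i_t}` is an
eigenvector of `g` (`NormalDatum.IsPerfect.mulVec_single_i`). As `q (e_{i_t}) = 1` its eigenvalue
has square `1`, hence is `1`, and by duality the diagonal entry at `j_t` is `1` as well. So `π(B_q)`
is a point.

It remains to count the matchings without nesting. Reading the left ends `i_t` as up steps and the
right ends `j_t` as down steps gives a lattice path with `2r` steps, which never goes below its
starting level and ends there. The path determines the matching, whose `t`-th left end has to be
paired with the `t`-th right end, and the connected components are the pieces of the path between
consecutive visits of the starting level (`bijOn_squareSupport`). Removing the last step shows by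
induction that there are `C(u - 1, d - f)` such paths with `u` up steps, `d ≤ u` down steps and `f`
returns (`card_ballotSets`); `u = d = r` gives the claim.
-/

/-! ### Non-degenerate normal forms are perfect matchings -/

namespace NormalDatum

variable {n : ℕ} (D : NormalDatum n) (Ω : Type*) [Field Ω]

theorem i_ne_i {s t : Fin D.m} (h : s ≠ t) : D.i s ≠ D.i t := fun e => h (D.i_strictMono.injective e)

theorem i_ne_j_of_ne {s t : Fin D.m} (h : s ≠ t) : D.i s ≠ D.j t := fun e =>
  Set.disjoint_left.mp (D.disjoint s t h) (Set.mem_insert _ _) (by simp [e])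

theorem j_ne_j {s t : Fin D.m} (h : s ≠ t) : D.j s ≠ D.j t := fun e =>
  Set.disjoint_left.mp (D.disjoint s t h) (by simp : D.j s ∈ _) (by simp [e])

theorem toForm_apply (v : Fin n → Ω) :
    D.toForm Ω v = ∑ t, ((if D.ε t = true then v (D.i t) * v (D.i t) else 0) +
      (if D.δ t = true then v (D.i t) * v (D.j t) else 0)) := by
  simp only [toForm, sum_apply, component, add_apply]
  refine Finset.sum_congr rfl fun t _ => ?_
  congr 1 <;> split_ifs <;> simp

/-- The squares `ε_t x_{i_t}^2` do not contribute to the polar form in characteristic `2`. -/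
theorem polar_toForm [CharP Ω 2] (v w : Fin n → Ω) :
    QuadraticMap.polar (D.toForm Ω) v w =
      ∑ t, if D.δ t = true then v (D.i t) * w (D.j t) + w (D.i t) * v (D.j t) else 0 := by
  simp only [QuadraticMap.polar, toForm_apply, ← Finset.sum_sub_distrib]
  refine Finset.sum_congr rfl fun t _ => ?_
  have h2 : (2 : Ω) = 0 := CharTwo.two_eq_zero
  simp only [Pi.add_apply]
  split_ifs
  · linear_combination v (D.i t) * w (D.i t) * h2
  · linear_combination v (D.i t) * w (D.i t) * h2
  · ring
  · ring

/-- The basis vector of a variable which does not occur in the form lies in the radical. -/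
theorem exists_eq_of_radical_eq_bot [CharP Ω 2] (h : (D.toForm Ω).radical = ⊥) (a : Fin n) :
    ∃ t, a = D.i t ∨ a = D.j t := by
  by_contra! hc
  have hm : (Pi.single a 1 : Fin n → Ω) ∈ (D.toForm Ω).radical := by
    rw [QuadraticMap.mem_radical_iff']
    have h0 : D.toForm Ω (Pi.single a 1) = 0 := by
      rw [toForm_apply]
      refine Finset.sum_eq_zero fun t _ => ?_
      simp [Pi.single_eq_of_ne (hc t).1.symm]
    refine ⟨h0, fun w => ?_⟩
    have hp := D.polar_toForm Ω (Pi.single a 1) w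
    rw [Finset.sum_eq_zero fun t _ => by
      simp [Pi.single_eq_of_ne (hc t).1.symm, Pi.single_eq_of_ne (hc t).2.symm]] at hp
    rw [QuadraticMap.polar, h0, sub_zero, sub_eq_zero] at hp
    exact hp
  rw [h, Submodule.mem_bot] at hm
  have := congrFun hm a
  simp at this

/-- All the indices occur, so a pure square would be the only one and leave an odd number of
indices for the remaining components, which use two each. -/
theorem δ_eq_true_of_covering {r : ℕ} (D : NormalDatum (2 * r))
    (h : ∀ a, ∃ t, a = D.i t ∨ a = D.j t) (t : Fin D.m) : D.δ t = true := by
  by_contra ht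
  rw [Bool.not_eq_true] at ht
  have huniq : ∀ s, s ≠ t → D.δ s = true := by
    intro s hs
    by_contra hs'
    rw [Bool.not_eq_true] at hs'
    have e1 : D.ε t = true := (D.ne_zero t).resolve_right (by simp [ht])
    have e2 : D.ε s = true := (D.ne_zero s).resolve_right (by simp [hs'])
    rcases lt_or_gt_of_ne hs with hlt | hlt
    · simp [D.square_last s e2 hs' t hlt] at e1
    · simp [D.square_last t e1 ht s hlt] at e2
  have hU : (Finset.univ : Finset (Fin (2 * r))) =
      Finset.univ.biUnion fun s => ({D.i s, D.j s} : Finset (Fin (2 * r))) := by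
    ext a
    simpa using h a
  have hcard := congrArg Finset.card hU
  rw [Finset.card_biUnion] at hcard
  · have hs : ∀ s, ({D.i s, D.j s} : Finset (Fin (2 * r))).card = if s = t then 1 else 2 := by
      intro s
      split_ifs with hst
      · subst hst
        rw [(D.eq_iff s).mpr ht]
        simp
      · refine Finset.card_pair fun e => ?_
        have := (D.eq_iff s).mp e.symm
        simp [huniq s hst] at this
    simp only [hs, Finset.card_univ, Fintype.card_fin] at hcard
    rw [← Finset.add_sum_erase _ _ (Finset.mem_univ t),
      Finset.sum_congr rfl fun s hs' => if_neg (Finset.ne_of_mem_erase hs')] at hcard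
    simp only [if_true, Finset.sum_const, smul_eq_mul] at hcard
    omega
  · intro s _ s' _ hne
    rw [Function.onFun, ← Finset.disjoint_coe]
    simpa using D.disjoint s s' hne

/-- Every index occurs, and every component is of the form `ε_t x_{i_t}^2 + x_{i_t} x_{j_t}`: the
pairs `(i_t, j_t)` form a perfect matching of the indices. -/
structure IsPerfect : Prop where
  δ_eq : ∀ t, D.δ t = true
  covers : ∀ a, ∃ t, a = D.i t ∨ a = D.j t

namespace IsPerfect

variable {D} {Ω} (h : D.IsPerfect)
include h

theorem i_lt_j (t : Fin D.m) : D.i t < D.j t := by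
  refine lt_of_le_of_ne (D.i_le_j t) fun e => ?_
  have := (D.eq_iff t).mp e.symm
  simp [h.δ_eq t] at this

theorem i_ne_j (s t : Fin D.m) : D.i s ≠ D.j t := by
  by_cases hst : s = t
  · subst hst; exact (h.i_lt_j s).ne
  · exact D.i_ne_j_of_ne hst

theorem polar_single_i [CharP Ω 2] (v : Fin n → Ω) (s : Fin D.m) :
    QuadraticMap.polar (D.toForm Ω) v (Pi.single (D.i s) 1) = v (D.j s) := by
  rw [polar_toForm, Finset.sum_eq_single s]
  · simp [h.δ_eq, Pi.single_eq_of_ne (h.i_ne_j s s).symm]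
  · intro t _ hts
    simp [Pi.single_eq_of_ne (D.i_ne_i hts), Pi.single_eq_of_ne (h.i_ne_j s t).symm]
  · simp

theorem polar_single_j [CharP Ω 2] (v : Fin n → Ω) (s : Fin D.m) :
    QuadraticMap.polar (D.toForm Ω) v (Pi.single (D.j s) 1) = v (D.i s) := by
  rw [polar_toForm, Finset.sum_eq_single s]
  · simp [h.δ_eq, Pi.single_eq_of_ne (h.i_ne_j s s)]
  · intro t _ hts
    simp [Pi.single_eq_of_ne (D.j_ne_j hts), Pi.single_eq_of_ne (h.i_ne_j t s)]
  · simp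

theorem toForm_single_i (s : Fin D.m) (c : Ω) :
    D.toForm Ω (Pi.single (D.i s) c) = if D.ε s = true then c * c else 0 := by
  rw [toForm_apply, Finset.sum_eq_single s]
  · simp [Pi.single_eq_of_ne (h.i_ne_j s s).symm]
  · intro t _ hts
    simp [Pi.single_eq_of_ne (D.i_ne_i hts)]
  · simp

theorem toForm_single_j (s : Fin D.m) (c : Ω) : D.toForm Ω (Pi.single (D.j s) c) = 0 := by
  rw [toForm_apply]
  refine Finset.sum_eq_zero fun t _ => ?_
  simp [Pi.single_eq_of_ne (h.i_ne_j t s)]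

theorem radical_eq_bot [CharP Ω 2] : (D.toForm Ω).radical = ⊥ := by
  rw [eq_bot_iff]
  intro v hv
  rw [QuadraticMap.mem_radical_iff'] at hv
  have hp : ∀ w, QuadraticMap.polar (D.toForm Ω) v w = 0 := fun w => by
    simp [QuadraticMap.polar, hv.2, hv.1]
  rw [Submodule.mem_bot]
  funext a
  obtain ⟨t, rfl | rfl⟩ := h.covers a
  · rw [← h.polar_single_j (Ω := Ω) v, hp]; rfl
  · rw [← h.polar_single_i (Ω := Ω) v, hp]; rfl

end IsPerfect

theorem isPerfect_of_radical_eq_bot [CharP Ω 2] {r : ℕ} (D : NormalDatum (2 * r))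
    (h : (D.toForm Ω).radical = ⊥) : D.IsPerfect where
  δ_eq := δ_eq_true_of_covering D (D.exists_eq_of_radical_eq_bot Ω h)
  covers := D.exists_eq_of_radical_eq_bot Ω h

/-- With all `ε_t = 1`, the condition on nested pairs says that no pairs are nested. -/
theorem IsPerfect.j_strictMono {D : NormalDatum n} (h : D.IsPerfect) (hε : ∀ t, D.ε t = true) :
    StrictMono D.j := by
  intro s t hst
  by_contra hc
  have hlt : D.j t < D.j s := lt_of_le_of_ne (not_lt.mp hc) (D.j_ne_j hst.ne')
  exact D.nested s t hst.ne (D.i_strictMono hst) (h.i_lt_j t) hlt ⟨hε s, hε t⟩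

end NormalDatum

/-! ### The stabilizer of a form without nested pairs -/

theorem formAction_apply {n : ℕ} {Ω : Type*} [Field Ω] (g : GL (Fin n) Ω)
    (q : QuadraticForm Ω (Fin n → Ω)) (v : Fin n → Ω) :
    formAction g q v = q ((g : Matrix (Fin n) (Fin n) Ω).mulVec v) := by
  simp [formAction]

theorem inv_mem_borelStabilizer {n : ℕ} {Ω : Type*} [Field Ω] {q : QuadraticForm Ω (Fin n → Ω)}
    {g : GL (Fin n) Ω} (hg : g ∈ borelStabilizer q) : g⁻¹ ∈ borelStabilizer q := by
  refine ⟨inv_mem hg.1, ?_⟩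
  ext v
  nth_rewrite 1 [← hg.2]
  rw [formAction_apply, formAction_apply, Matrix.mulVec_mulVec, ← Units.val_mul]
  simp

/-- An element of the stabilizer preserves the polar form, so its inverse is its adjoint. -/
theorem polar_mulVec_of_mem_borelStabilizer {n : ℕ} {Ω : Type*} [Field Ω]
    {q : QuadraticForm Ω (Fin n → Ω)} {g : GL (Fin n) Ω} (hg : g ∈ borelStabilizer q)
    (v w : Fin n → Ω) :
    QuadraticMap.polar q ((g : Matrix (Fin n) (Fin n) Ω).mulVec v) w =
      QuadraticMap.polar q v (((g⁻¹ : GL (Fin n) Ω) : Matrix (Fin n) (Fin n) Ω).mulVec w) := by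
  have key : ∀ u, q ((g : Matrix (Fin n) (Fin n) Ω).mulVec u) = q u := fun u => by
    rw [← formAction_apply, hg.2]
  have hw : w = (g : Matrix (Fin n) (Fin n) Ω).mulVec
      (((g⁻¹ : GL (Fin n) Ω) : Matrix (Fin n) (Fin n) Ω).mulVec w) := by
    rw [Matrix.mulVec_mulVec, ← Units.val_mul]
    simp
  nth_rewrite 1 [hw]
  simp only [QuadraticMap.polar, ← Matrix.mulVec_add, key]

namespace NormalDatum.IsPerfect

variable {n : ℕ} {D : NormalDatum n} {Ω : Type*} [Field Ω] [CharP Ω 2] (h : D.IsPerfect)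
  (hε : ∀ t, D.ε t = true)
include h hε

/-- The entries of `g` and `g⁻¹` in the columns of the left ends `i_t` are interchanged by the
matching; as both matrices are upper triangular and no pairs are nested, the left ends give
eigenvectors of `g`. -/
theorem mulVec_single_i {g : GL (Fin n) Ω} (hg : g ∈ borelStabilizer (D.toForm Ω)) (t : Fin D.m) :
    (g : Matrix (Fin n) (Fin n) Ω).mulVec (Pi.single (D.i t) 1) =
      Pi.single (D.i t) ((g : Matrix (Fin n) (Fin n) Ω) (D.i t) (D.i t)) := by
  have hinv : ((g⁻¹ : GL (Fin n) Ω) : Matrix (Fin n) (Fin n) Ω).BlockTriangular id :=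
    (inv_mem_borelStabilizer hg).1
  have hup : (g : Matrix (Fin n) (Fin n) Ω).BlockTriangular id := hg.1
  have hj := h.j_strictMono hε
  funext a
  rw [Matrix.mulVec_single_one, Matrix.col_apply]
  by_cases ha : a = D.i t
  · subst ha; simp
  rw [Pi.single_eq_of_ne ha]
  obtain ⟨s, rfl | rfl⟩ := h.covers a
  · have e := polar_mulVec_of_mem_borelStabilizer hg (Pi.single (D.i t) 1) (Pi.single (D.j s) 1)
    rw [h.polar_single_j, QuadraticMap.polar_comm, h.polar_single_i, Matrix.mulVec_single_one,
      Matrix.mulVec_single_one, Matrix.col_apply, Matrix.col_apply] at e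
    rcases lt_or_ge s t with hst | hst
    · rw [e]; exact hinv (hj hst)
    · exact hup (D.i_strictMono (lt_of_le_of_ne hst fun e => ha (by rw [e])))
  · have e := polar_mulVec_of_mem_borelStabilizer hg (Pi.single (D.i t) 1) (Pi.single (D.i s) 1)
    rw [h.polar_single_i, QuadraticMap.polar_comm, h.polar_single_i, Matrix.mulVec_single_one,
      Matrix.mulVec_single_one, Matrix.col_apply, Matrix.col_apply] at e
    rcases lt_or_ge (D.i t) (D.j s) with hst | hst
    · exact hup hst
    · rw [e]; exact hinv (((h.i_lt_j s).trans_le hst).trans (h.i_lt_j t))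

/-- The eigenvalue on `e_{i_t}` has square `1`, since `q (e_{i_t}) = 1`. -/
theorem diag_i_eq_one {g : GL (Fin n) Ω} (hg : g ∈ borelStabilizer (D.toForm Ω)) (t : Fin D.m) :
    (g : Matrix (Fin n) (Fin n) Ω) (D.i t) (D.i t) = 1 := by
  have e : D.toForm Ω ((g : Matrix (Fin n) (Fin n) Ω).mulVec (Pi.single (D.i t) 1)) =
      D.toForm Ω (Pi.single (D.i t) 1) := by
    rw [← formAction_apply, hg.2]
  rw [h.mulVec_single_i hε hg, h.toForm_single_i, h.toForm_single_i, if_pos (hε t), if_pos (hε t),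
    mul_one] at e
  rcases mul_self_eq_one_iff.mp e with e | e
  · exact e
  · rw [e, CharTwo.neg_eq]

theorem diag_j_eq_one {g : GL (Fin n) Ω} (hg : g ∈ borelStabilizer (D.toForm Ω)) (t : Fin D.m) :
    (g : Matrix (Fin n) (Fin n) Ω) (D.j t) (D.j t) = 1 := by
  have e := polar_mulVec_of_mem_borelStabilizer hg (Pi.single (D.j t) 1) (Pi.single (D.i t) 1)
  rw [h.polar_single_i, QuadraticMap.polar_comm, h.polar_single_j, Matrix.mulVec_single_one,
    Matrix.mulVec_single_one, Matrix.col_apply, Matrix.col_apply] at e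
  rw [e, h.diag_i_eq_one hε (inv_mem_borelStabilizer hg)]

theorem torusImage_eq : torusImage (D.toForm Ω) = {1} := by
  ext d
  rw [Set.mem_singleton_iff]
  constructor
  · rintro ⟨g, hg, rfl⟩
    funext a
    obtain ⟨t, rfl | rfl⟩ := h.covers a
    · exact h.diag_i_eq_one hε hg t
    · exact h.diag_j_eq_one hε hg t
  · rintro rfl
    refine ⟨1, ⟨one_mem _, ?_⟩, ?_⟩
    · ext v; simp [formAction]
    · ext i; simp

end NormalDatum.IsPerfect

/-! ### Dimension of the torus image -/

theorem bRank_eq_iff {n : ℕ} {Ω : Type*} [Field Ω] (q : QuadraticForm Ω (Fin n → Ω)) :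
    bRank q = n ↔ affineDim (torusImage q) = 0 := by
  have key := bRank_add_affineDim q
  constructor
  · intro h
    rw [h] at key
    generalize affineDim (torusImage q) = d at key
    induction d with
    | bot => simp at key
    | coe d =>
      norm_cast at key ⊢
      induction d using ENat.recTopCoe with
      | top => simp at key
      | coe d =>
        norm_cast at key ⊢
        omega
  · intro h
    rw [h, add_zero] at key
    exact_mod_cast key

theorem affineDim_singleton {n : ℕ} {Ω : Type*} [Field Ω] (x : Fin n → Ω) :
    affineDim ({x} : Set (Fin n → Ω)) = 0 := by
  have : (MvPolynomial.vanishingIdeal Ω ({x} : Set (Fin n → Ω))).IsMaximal := inferInstance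
  have := Ideal.Quotient.field (MvPolynomial.vanishingIdeal Ω ({x} : Set (Fin n → Ω)))
  exact ringKrullDim_eq_zero_of_isField
    ((Ideal.Quotient.maximal_ideal_iff_isField_quotient _).mp ‹_›)

/-- On a set of dimension zero each coordinate function is algebraic over `Ω`. -/
theorem finite_image_of_affineDim_eq_zero {n : ℕ} {Ω : Type*} [Field Ω] {S : Set (Fin n → Ω)}
    (hS : affineDim S = 0) (a : Fin n) : ((fun v => v a) '' S).Finite := by
  classical
  let A := MvPolynomial (Fin n) Ω ⧸ MvPolynomial.vanishingIdeal Ω S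
  have hd : Ring.KrullDimLE 0 A := by
    rw [Ring.krullDimLE_iff]
    exact hS.le
  have hfin : Module.Finite Ω A := by
    rw [Module.finite_iff_isArtinianRing, isArtinianRing_iff_krullDimLE_zero]
    exact hd
  obtain ⟨p, hp, hpa⟩ := Algebra.IsIntegral.isIntegral (R := Ω)
    (Ideal.Quotient.mk (MvPolynomial.vanishingIdeal Ω S) (MvPolynomial.X a) : A)
  refine p.roots.toFinset.finite_toSet.subset ?_
  rintro _ ⟨v, hv, rfl⟩
  have hmem : Polynomial.aeval (MvPolynomial.X a : MvPolynomial (Fin n) Ω) p ∈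
      MvPolynomial.vanishingIdeal Ω S := by
    rw [← Ideal.Quotient.eq_zero_iff_mem, ← hpa, ← Ideal.Quotient.mkₐ_eq_mk Ω,
      ← Polynomial.aeval_algHom_apply]
    rfl
  have := hmem v hv
  rw [← Polynomial.aeval_algHom_apply, MvPolynomial.aeval_X] at this
  simpa [hp.ne_zero] using this

theorem IsQuadraticallyClosed.infinite {Ω : Type*} [Field Ω] [CharP Ω 2]
    (hΩ : IsQuadraticallyClosed Ω) : Infinite Ω := by
  by_contra hfin
  rw [not_infinite_iff_finite] at hfin
  -- the map `x ↦ x ^ 2 + x` is onto, but takes the value `0` at both `0` and `1`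
  have hsurj : Function.Surjective fun x : Ω => x ^ 2 + x := fun b => by
    obtain ⟨x, hx⟩ := hΩ 1 b
    refine ⟨x, ?_⟩
    rw [one_mul] at hx
    change x ^ 2 + x = b
    rw [eq_neg_of_add_eq_zero_left hx, CharTwo.neg_eq]
  have hinj := Finite.injective_iff_surjective.mpr hsurj
  have : (0 : Ω) = 1 := hinj (by simp [one_add_one_eq_two, CharTwo.two_eq_zero])
  exact zero_ne_one this

namespace NormalDatum.IsPerfect

variable {n : ℕ} {D : NormalDatum n} {Ω : Type*} [Field Ω] (h : D.IsPerfect)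
include h

/-- A component `x_i x_j` is preserved by the one-parameter torus scaling `x_i` by `c` and `x_j` by
`c⁻¹`. -/
theorem exists_mem_torusImage {t : Fin D.m} (ht : D.ε t = false) {c : Ω} (hc : c ≠ 0) :
    ∃ d ∈ torusImage (D.toForm Ω), d (D.i t) = c := by
  let d : Fin n → Ω := Function.update (Function.update 1 (D.j t) c⁻¹) (D.i t) c
  have hdi : d (D.i t) = c := by simp [d]
  have hdj : d (D.j t) = c⁻¹ := by
    simp [d, Function.update_of_ne (h.i_ne_j t t).symm]
  have hd : ∀ a, a ≠ D.i t → a ≠ D.j t → d a = 1 := fun a h1 h2 => by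
    simp [d, Function.update_of_ne h1, Function.update_of_ne h2]
  have hd0 : ∀ a, d a ≠ 0 := by
    intro a
    by_cases h1 : a = D.i t
    · rw [h1, hdi]; exact hc
    · by_cases h2 : a = D.j t
      · rw [h2, hdj]; exact inv_ne_zero hc
      · rw [hd a h1 h2]; exact one_ne_zero
  have hdet : (Matrix.diagonal d).det ≠ 0 := by
    rw [Matrix.det_diagonal]
    exact Finset.prod_ne_zero_iff.mpr fun a _ => hd0 a
  refine ⟨d, ⟨Matrix.GeneralLinearGroup.mkOfDetNeZero _ hdet, ⟨?_, ?_⟩, ?_⟩, hdi⟩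
  · exact Matrix.blockTriangular_diagonal d
  · ext v
    rw [formAction_apply, toForm_apply, toForm_apply]
    refine Finset.sum_congr rfl fun s _ => ?_
    have hv : ∀ a, ((Matrix.GeneralLinearGroup.mkOfDetNeZero _ hdet : GL (Fin n) Ω) :
        Matrix (Fin n) (Fin n) Ω).mulVec v a = d a * v a := fun a => by
      change (Matrix.diagonal d).mulVec v a = _
      rw [Matrix.mulVec_diagonal]
    rw [hv, hv]
    by_cases hst : s = t
    · subst hst
      rw [hdi, hdj, ht]
      have : c * v (D.i s) * (c⁻¹ * v (D.j s)) = v (D.i s) * v (D.j s) := by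
        field_simp
      simp [this]
    · rw [hd _ (D.i_ne_i hst) (h.i_ne_j s t), hd _ (h.i_ne_j t s).symm (D.j_ne_j hst), one_mul,
        one_mul]
  · change (Matrix.diagonal d).diag = d
    simp

theorem bRank_eq_iff [CharP Ω 2] [Infinite Ω] : bRank (D.toForm Ω) = n ↔ ∀ t, D.ε t = true := by
  rw [_root_.bRank_eq_iff]
  constructor
  · intro h0 t
    by_contra ht
    rw [Bool.not_eq_true] at ht
    have hfin := finite_image_of_affineDim_eq_zero h0 (D.i t)
    refine (Set.finite_singleton (0 : Ω)).infinite_compl (hfin.subset fun c hc => ?_)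
    exact h.exists_mem_torusImage ht hc
  · intro hε
    rw [h.torusImage_eq hε, affineDim_singleton]

end NormalDatum.IsPerfect

/-! ### Counting ballot paths by returns -/

theorem catalanTriangleNat_eq_zero_of_lt {n k : ℕ} (h : n < k) : catalanTriangleNat n k = 0 := by
  obtain ⟨k, rfl⟩ := Nat.exists_eq_succ_of_ne_zero (by omega : k ≠ 0)
  cases n with
  | zero => rw [catalanTriangleNat]
  | succ n => rw [catalanTriangleNat, if_neg (by omega), if_neg (by omega)]

theorem catalanTriangleNat_zero_right (n : ℕ) : catalanTriangleNat n 0 = 1 := by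
  induction n with
  | zero => rw [catalanTriangleNat]
  | succ n ih => rw [catalanTriangleNat, ih]

/-- On and below the diagonal of the triangle a single recursion holds, since the entries above the
diagonal vanish. -/
theorem catalanTriangleNat_succ_succ {n k : ℕ} (h : k ≤ n) :
    catalanTriangleNat (n + 1) (k + 1) =
      catalanTriangleNat (n + 1) k + catalanTriangleNat n (k + 1) := by
  rw [catalanTriangleNat]
  split_ifs with h1 h2
  · rfl
  · rw [catalanTriangleNat_eq_zero_of_lt (by omega : n < k + 1), add_zero]
  · omega

/-- The number of elements of `I` smaller than `k`. If `I` is the set of positions of the up steps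
of a lattice path, this is the number of up steps among the first `k` steps. -/
def countBelow (I : Finset ℕ) (k : ℕ) : ℕ := (I.filter (· < k)).card

/-- The sets of positions of the up steps of the lattice paths with `L` steps, `u` of them up, which
never go below the starting level and return to it exactly `f` times. After `k` steps the level is
`2 * countBelow I k - k`. -/
def ballotSets (L u f : ℕ) : Finset (Finset ℕ) :=
  (Finset.powersetCard u (Finset.range L)).filter fun I =>
    (∀ k ≤ L, k ≤ 2 * countBelow I k) ∧
      ((Finset.range L).filter fun k => 2 * countBelow I (k + 1) = k + 1).card = f

theorem mem_ballotSets {L u f : ℕ} {I : Finset ℕ} : I ∈ ballotSets L u f ↔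
    (I ⊆ Finset.range L ∧ I.card = u) ∧ (∀ k ≤ L, k ≤ 2 * countBelow I k) ∧
      ((Finset.range L).filter fun k => 2 * countBelow I (k + 1) = k + 1).card = f := by
  rw [ballotSets, Finset.mem_filter, Finset.mem_powersetCard]

theorem countBelow_of_subset_range {L : ℕ} {I : Finset ℕ} (h : I ⊆ Finset.range L) :
    countBelow I L = I.card := by
  rw [countBelow, Finset.filter_true_of_mem fun x hx => Finset.mem_range.mp (h hx)]

theorem countBelow_insert {L k : ℕ} {I : Finset ℕ} (hk : k ≤ L) :
    countBelow (insert L I) k = countBelow I k := by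
  rw [countBelow, countBelow, Finset.filter_insert, if_neg (by omega)]

/-- Dropping the last step of a path. -/
theorem mem_ballotSets_succ {L u f : ℕ} {I : Finset ℕ} (h : I ⊆ Finset.range (L + 1)) :
    I ∈ ballotSets (L + 1) u f ↔ I.card = u ∧ L + 1 ≤ 2 * u ∧
      (∀ k ≤ L, k ≤ 2 * countBelow I k) ∧
      ((Finset.range L).filter fun k => 2 * countBelow I (k + 1) = k + 1).card +
        (if 2 * u = L + 1 then 1 else 0) = f := by
  rw [mem_ballotSets, Finset.range_add_one, Finset.filter_insert, ← Finset.range_add_one,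
    countBelow_of_subset_range h]
  constructor
  · rintro ⟨⟨-, rfl⟩, h1, h2⟩
    refine ⟨rfl, ?_, fun k hk => h1 k (by omega), ?_⟩
    · have := h1 (L + 1) le_rfl
      rwa [countBelow_of_subset_range h] at this
    · rw [← h2]
      split_ifs
      · rw [Finset.card_insert_of_notMem (by simp)]
      · rfl
  · rintro ⟨rfl, h0, h1, h2⟩
    refine ⟨⟨h, rfl⟩, fun k hk => ?_, ?_⟩
    · rcases Nat.lt_or_ge L k with hlt | hle
      · obtain rfl : k = L + 1 := by omega
        rwa [countBelow_of_subset_range h]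
      · exact h1 k hle
    · rw [← h2]
      split_ifs
      · rw [Finset.card_insert_of_notMem (by simp)]
      · rfl

theorem mem_ballotSets_succ_of_subset {L u f : ℕ} {I : Finset ℕ} (h : I ⊆ Finset.range L) :
    I ∈ ballotSets (L + 1) u f ↔ L + 1 ≤ 2 * u ∧
      ∃ f', I ∈ ballotSets L u f' ∧ f' + (if 2 * u = L + 1 then 1 else 0) = f := by
  rw [mem_ballotSets_succ (h.trans (Finset.range_subset_range.mpr (Nat.le_succ L)))]
  simp only [mem_ballotSets]
  aesop

theorem insert_mem_ballotSets_succ {L u f : ℕ} {I : Finset ℕ} (h : I ⊆ Finset.range L) :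
    insert L I ∈ ballotSets (L + 1) (u + 1) f ↔ L + 1 ≤ 2 * (u + 1) ∧
      ∃ f', I ∈ ballotSets L u f' ∧ f' + (if 2 * (u + 1) = L + 1 then 1 else 0) = f := by
  have hL : L ∉ I := fun hm => by simpa using h hm
  rw [mem_ballotSets_succ, Finset.card_insert_of_notMem hL]
  · have e1 : (∀ k ≤ L, k ≤ 2 * countBelow (insert L I) k) ↔ ∀ k ≤ L, k ≤ 2 * countBelow I k :=
      forall₂_congr fun k hk => by rw [countBelow_insert hk]
    have e2 : ((Finset.range L).filter fun k => 2 * countBelow (insert L I) (k + 1) = k + 1) =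
        (Finset.range L).filter fun k => 2 * countBelow I (k + 1) = k + 1 :=
      Finset.filter_congr fun k hk => by rw [countBelow_insert (Finset.mem_range.mp hk)]
    rw [e1, e2]
    simp only [mem_ballotSets, add_left_inj]
    aesop
  · rw [Finset.range_add_one]
    exact Finset.insert_subset_insert _ h

theorem card_ballotSets_succ_of_lt {L u f : ℕ} (h : L + 1 < 2 * (u + 1)) :
    (ballotSets (L + 1) (u + 1) f).card =
      (ballotSets L (u + 1) f).card + (ballotSets L u f).card := by
  have hsub : ∀ {v} {I : Finset ℕ}, I ∈ ballotSets L v f → I ⊆ Finset.range L :=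
    fun hI => (mem_ballotSets.mp hI).1.1
  have e : ballotSets (L + 1) (u + 1) f =
      ballotSets L (u + 1) f ∪ (ballotSets L u f).image (insert L) := by
    ext I
    rw [Finset.mem_union, Finset.mem_image]
    constructor
    · intro hI
      have hr := (mem_ballotSets.mp hI).1.1
      rw [Finset.range_add_one] at hr
      by_cases hL : L ∈ I
      · right
        refine ⟨I.erase L, ?_, Finset.insert_erase hL⟩
        have hs := Finset.subset_insert_iff.mp hr
        rw [← Finset.insert_erase hL, insert_mem_ballotSets_succ hs, if_neg h.ne'] at hI
        simpa using hI.2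
      · left
        have hs := (Finset.subset_insert_iff_of_notMem hL).mp hr
        rw [mem_ballotSets_succ_of_subset hs, if_neg h.ne'] at hI
        simpa using hI.2
    · rintro (hI | ⟨I, hI, rfl⟩)
      · rw [mem_ballotSets_succ_of_subset (hsub hI), if_neg h.ne']
        exact ⟨h.le, f, hI, rfl⟩
      · rw [insert_mem_ballotSets_succ (hsub hI), if_neg h.ne']
        exact ⟨h.le, f, hI, rfl⟩
  have hnot : ∀ {v} {I : Finset ℕ}, I ∈ ballotSets L v f → L ∉ I :=
    fun hI hm => by simpa using hsub hI hm
  rw [e, Finset.card_union_of_disjoint, Finset.card_image_of_injOn]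
  · intro I hI J hJ hIJ
    rw [← Finset.erase_insert (hnot hI), ← Finset.erase_insert (hnot hJ)]
    exact congrArg (fun K => K.erase L) hIJ
  · rw [Finset.disjoint_left]
    intro I hI hI'
    obtain ⟨J, -, rfl⟩ := Finset.mem_image.mp hI'
    exact hnot hI (Finset.mem_insert_self _ _)

/-- The last step of a path ending at the starting level is a down step and a return. -/
theorem mem_ballotSets_two_mul {u f : ℕ} {I : Finset ℕ} :
    I ∈ ballotSets (2 * u + 2) (u + 1) f ↔
      ∃ f', I ∈ ballotSets (2 * u + 1) (u + 1) f' ∧ f' + 1 = f := by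
  have e : 2 * (u + 1) = 2 * u + 1 + 1 := by ring
  constructor
  · intro hI
    have hr := (mem_ballotSets.mp hI).1.1
    rw [Finset.range_add_one] at hr
    by_cases hL : 2 * u + 1 ∈ I
    · have hs := Finset.subset_insert_iff.mp hr
      rw [← Finset.insert_erase hL, insert_mem_ballotSets_succ hs] at hI
      obtain ⟨-, f', hf', -⟩ := hI
      obtain ⟨⟨-, h1⟩, h2, -⟩ := mem_ballotSets.mp hf'
      have := h2 _ le_rfl
      rw [countBelow_of_subset_range hs] at this
      omega
    · have hs := (Finset.subset_insert_iff_of_notMem hL).mp hr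
      rw [mem_ballotSets_succ_of_subset hs, if_pos e] at hI
      exact hI.2
  · rintro ⟨f', hI, rfl⟩
    rw [mem_ballotSets_succ_of_subset (mem_ballotSets.mp hI).1.1, if_pos e]
    exact ⟨e.ge, f', hI, rfl⟩

theorem card_ballotSets_two_mul_zero (u : ℕ) : (ballotSets (2 * u + 2) (u + 1) 0).card = 0 := by
  rw [Finset.card_eq_zero, Finset.eq_empty_iff_forall_notMem]
  intro I hI
  obtain ⟨f', -, hf'⟩ := mem_ballotSets_two_mul.mp hI
  omega

theorem card_ballotSets_two_mul_succ (u f : ℕ) :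
    (ballotSets (2 * u + 2) (u + 1) (f + 1)).card = (ballotSets (2 * u + 1) (u + 1) f).card := by
  congr 1
  ext I
  rw [mem_ballotSets_two_mul]
  simp

theorem ballotSets_eq_empty_of_lt {L u f : ℕ} (h : L < u) : ballotSets L u f = ∅ := by
  rw [ballotSets, Finset.powersetCard_eq_empty.mpr (by simpa using h), Finset.filter_empty]

theorem card_ballotSets_zero (f : ℕ) :
    (ballotSets 0 0 f).card = if f = 0 then 1 else 0 := by
  have : ballotSets 0 0 f = if f = 0 then {∅} else ∅ := by
    ext I
    rw [mem_ballotSets]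
    split_ifs with hf
    · subst hf
      simp +contextual [countBelow]
    · simp [eq_comm, hf]
  rw [this]
  split_ifs <;> rfl

/-- The number of ballot paths with `u + 1` up steps, `d` down steps and `f` returns. The formula
is the same for the paths which end at the starting level, where the last step is forced, and for
those which do not. -/
theorem card_ballotSets {L u d : ℕ} (f : ℕ) (hL : L = u + 1 + d) (hd : d ≤ u + 1) :
    (ballotSets L (u + 1) f).card = if f ≤ d then catalanTriangleNat u (d - f) else 0 := by
  induction L generalizing u d f with
  | zero => omega
  | succ L ih =>
    rcases Nat.lt_or_ge d (u + 1) with hlt | hge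
    · rw [card_ballotSets_succ_of_lt (by omega)]
      cases d with
      | zero =>
        rw [ballotSets_eq_empty_of_lt (by omega), Finset.card_empty, zero_add]
        cases u with
        | zero =>
          obtain rfl : L = 0 := by omega
          rw [card_ballotSets_zero]
          simp [catalanTriangleNat]
        | succ u =>
          rw [ih f (by omega : L = u + 1 + 0) (by omega)]
          simp [catalanTriangleNat_zero_right]
      | succ d =>
        obtain ⟨u, rfl⟩ := Nat.exists_eq_succ_of_ne_zero (by omega : u ≠ 0)
        rw [Nat.succ_eq_add_one, ih f (by omega : L = u + 1 + 1 + d) (by omega),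
          ih f (by omega : L = u + 1 + (d + 1)) (by omega)]
        rcases Nat.lt_or_ge d f with hf | hf
        · rw [if_neg (by omega), zero_add]
          split_ifs
          · obtain rfl : f = d + 1 := by omega
            simp [catalanTriangleNat_zero_right]
          · rfl
        · rw [if_pos hf, if_pos (by omega), if_pos (by omega), Nat.sub_add_comm hf,
            catalanTriangleNat_succ_succ (by omega)]
    · obtain rfl : d = u + 1 := by omega
      obtain rfl : L = 2 * u + 1 := by omega
      cases f with
      | zero =>
        rw [card_ballotSets_two_mul_zero, if_pos (by omega),
          catalanTriangleNat_eq_zero_of_lt (by omega)]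
      | succ f =>
        rw [card_ballotSets_two_mul_succ, ih f (by omega : 2 * u + 1 = u + 1 + u) (by omega)]
        simp

/-! ### Matchings and ballot paths -/

namespace NormalDatum

variable {n : ℕ} (D : NormalDatum n)

/-- The set of the left ends `i_t` of the pairs, as natural numbers. -/
def leftEnds : Finset ℕ := Finset.univ.image fun t => (D.i t : ℕ)

theorem leftEnds_subset : D.leftEnds ⊆ Finset.range n := by
  intro k hk
  obtain ⟨t, -, rfl⟩ := Finset.mem_image.mp hk
  exact Finset.mem_range.mpr (D.i t).isLt

theorem i_val_injective : Function.Injective fun t => (D.i t : ℕ) :=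
  Fin.val_injective.comp D.i_strictMono.injective

theorem card_leftEnds : D.leftEnds.card = D.m := by
  rw [leftEnds, Finset.card_image_of_injective _ D.i_val_injective, Finset.card_univ,
    Fintype.card_fin]

theorem countBelow_leftEnds (k : ℕ) :
    countBelow D.leftEnds k = (Finset.univ.filter fun t => (D.i t : ℕ) < k).card := by
  rw [countBelow, leftEnds, Finset.filter_image,
    Finset.card_image_of_injective _ D.i_val_injective]

/-- The form depends only on the data up to the identification of the index types `Fin D.m` and
`Fin D'.m`. -/
theorem toForm_eq_of_i_j_eq (Ω : Type*) [Field Ω] {D D' : NormalDatum n} (hm : D.m = D'.m)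
    (hi : ∀ t, D.i t = D'.i (Fin.cast hm t)) (hj : ∀ t, D.j t = D'.j (Fin.cast hm t))
    (hε : ∀ t, D.ε t = D'.ε (Fin.cast hm t)) (hδ : ∀ t, D.δ t = D'.δ (Fin.cast hm t)) :
    D.toForm Ω = D'.toForm Ω := by
  ext v
  rw [toForm_apply, toForm_apply]
  refine Fintype.sum_equiv (finCongr hm) _ _ fun t => ?_
  simp [hi, hj, hε, hδ]

theorem le_j_of_mem_ind {D : NormalDatum n} {t : Fin D.m} {a : Fin n} (ha : a ∈ D.ind t) : a ≤ D.j t := by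
  rcases ha with rfl | rfl
  · exact D.i_le_j t
  · exact le_rfl

theorem i_le_of_mem_ind {D : NormalDatum n} {t : Fin D.m} {a : Fin n} (ha : a ∈ D.ind t) : D.i t ≤ a := by
  rcases ha with rfl | rfl
  · exact le_rfl
  · exact D.i_le_j t

/-- A connected component is determined by its first pair, and a pair is the first one of a
component if and only if it lies to the right of all the previous pairs. -/
theorem numComponents_eq :
    D.numComponents = (Finset.univ.filter fun t => ∀ u < t, D.j u < D.i t).card := by
  have e : Prod.fst '' {p : Fin D.m × Fin D.m | D.IsConnectedComponent p.1 p.2} =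
      ((Finset.univ.filter fun t => ∀ u < t, D.j u < D.i t : Finset (Fin D.m)) :
        Set (Fin D.m)) := by
    ext s
    simp only [Set.mem_image, Set.mem_ofPred_eq, Prod.exists, exists_and_right, exists_eq_right,
      Finset.coe_filter, Finset.mem_univ, true_and]
    constructor
    · rintro ⟨e, hse, hsep, -⟩ u hu
      exact (hsep s le_rfl hse (D.i s) (Set.mem_insert _ _)).1 u hu (D.j u)
        (Set.mem_insert_of_mem _ rfl)
    · intro hs
      let last : Fin D.m := ⟨D.m - 1, by have := s.isLt; omega⟩
      have hlast : ∀ t, t ≤ last := fun t => by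
        rw [Fin.le_def]
        have := t.isLt
        change (t : ℕ) ≤ D.m - 1
        omega
      have hsep : D.Separated s last := by
        intro t hst _ a ha
        refine ⟨fun u hu c hc => ?_, fun u hu => absurd hu (hlast u).not_gt⟩
        exact ((le_j_of_mem_ind hc).trans_lt (hs u hu)).trans_le
          ((D.i_strictMono.monotone hst).trans (i_le_of_mem_ind ha))
      obtain ⟨e, ⟨he1, he2⟩, hmin⟩ := WellFounded.has_min (wellFounded_lt (α := Fin D.m))
        {e | s ≤ e ∧ D.Separated s e} ⟨last, hlast s, hsep⟩
      exact ⟨e, he1, he2, fun e' h1 h2 h3 => hmin e' ⟨h1, h3⟩ h2⟩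
  rw [numComponents, ← Set.ncard_coe_finset, ← e, Set.InjOn.ncard_image]
  rintro ⟨s, e⟩ ⟨h1, h2, h3⟩ ⟨s', e'⟩ ⟨h1', h2', h3'⟩ hss
  obtain rfl : s = s' := hss
  rcases lt_trichotomy e e' with hlt | rfl | hlt
  · exact absurd h2 (h3' e h1 hlt)
  · rfl
  · exact absurd h2' (h3 e' h1' hlt)

namespace IsPerfect

variable {D} (h : D.IsPerfect)
include h

/-- Each index below `k` is the left end or the right end of exactly one pair. -/
theorem card_i_lt_add_card_j_lt {k : ℕ} (hk : k ≤ n) :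
    (Finset.univ.filter fun t => (D.i t : ℕ) < k).card +
      (Finset.univ.filter fun t => (D.j t : ℕ) < k).card = k := by
  have hjinj : Function.Injective fun t => (D.j t : ℕ) := fun s t e => by
    by_contra hst
    exact D.j_ne_j hst (Fin.ext e)
  have e : Finset.range k = ((Finset.univ.filter fun t => (D.i t : ℕ) < k).image
      fun t => (D.i t : ℕ)) ∪ ((Finset.univ.filter fun t => (D.j t : ℕ) < k).image
      fun t => (D.j t : ℕ)) := by
    ext a
    simp only [Finset.mem_range, Finset.mem_union, Finset.mem_image, Finset.mem_filter,
      Finset.mem_univ, true_and]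
    constructor
    · intro ha
      obtain ⟨t, ht | ht⟩ := h.covers ⟨a, ha.trans_le hk⟩
      · exact Or.inl ⟨t, by simpa [← ht] using ha, by simp [← ht]⟩
      · exact Or.inr ⟨t, by simpa [← ht] using ha, by simp [← ht]⟩
    · rintro (⟨t, ht, rfl⟩ | ⟨t, ht, rfl⟩) <;> exact ht
  have hc := congrArg Finset.card e
  rw [Finset.card_range, Finset.card_union_of_disjoint,
    Finset.card_image_of_injective _ D.i_val_injective,
    Finset.card_image_of_injective _ hjinj] at hc
  · exact hc.symm
  · rw [Finset.disjoint_left]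
    intro a ha ha'
    obtain ⟨s, -, rfl⟩ := Finset.mem_image.mp ha
    obtain ⟨t, -, ht⟩ := Finset.mem_image.mp ha'
    exact h.i_ne_j s t (Fin.ext ht.symm)

theorem two_mul_m : 2 * D.m = n := by
  have := h.card_i_lt_add_card_j_lt le_rfl
  simp only [Fin.is_lt, Finset.filter_true, Finset.card_univ, Fintype.card_fin] at this
  omega

/-- The left ends of the pairs are the up steps of a ballot path. -/
theorem le_two_mul_countBelow {k : ℕ} (hk : k ≤ n) : k ≤ 2 * countBelow D.leftEnds k := by
  have e := h.card_i_lt_add_card_j_lt hk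
  have hle : (Finset.univ.filter fun t => (D.j t : ℕ) < k).card ≤
      (Finset.univ.filter fun t => (D.i t : ℕ) < k).card := by
    refine Finset.card_le_card fun t ht => ?_
    rw [Finset.mem_filter] at ht ⊢
    exact ⟨ht.1, lt_trans (h.i_lt_j t) ht.2⟩
  rw [countBelow_leftEnds]
  omega

theorem range_j : Set.range D.j = (Set.range D.i)ᶜ := by
  ext a
  constructor
  · rintro ⟨t, rfl⟩ ⟨s, hs⟩
    exact h.i_ne_j s t hs
  · intro ha
    obtain ⟨t, ht | ht⟩ := h.covers a
    · exact absurd ⟨t, ht.symm⟩ ha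
    · exact ⟨t, ht.symm⟩

/-- A pair lies to the right of all the previous ones if and only if the path is at its starting
level just before the left end of the pair. -/
theorem card_starts :
    (Finset.univ.filter fun t => ∀ u < t, D.j u < D.i t).card =
      ((Finset.range n).filter fun k => 2 * countBelow D.leftEnds k = k).card := by
  rw [← Finset.card_image_of_injective _ D.i_val_injective]
  congr 1
  have hsub : ∀ k : ℕ, (Finset.univ.filter fun t => (D.j t : ℕ) < k) ⊆
      Finset.univ.filter fun t => (D.i t : ℕ) < k := fun k t ht => by
    rw [Finset.mem_filter] at ht ⊢
    exact ⟨ht.1, lt_trans (h.i_lt_j t) ht.2⟩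
  ext k
  simp only [Finset.mem_image, Finset.mem_filter, Finset.mem_univ, true_and, Finset.mem_range,
    countBelow_leftEnds]
  constructor
  · rintro ⟨t, ht, rfl⟩
    refine ⟨(D.i t).isLt, ?_⟩
    have e := h.card_i_lt_add_card_j_lt (D.i t).isLt.le
    have e' : (Finset.univ.filter fun s => (D.j s : ℕ) < D.i t) =
        Finset.univ.filter fun s => (D.i s : ℕ) < D.i t := by
      refine (hsub _).antisymm fun s hs => ?_
      rw [Finset.mem_filter] at hs ⊢
      exact ⟨hs.1, ht s (D.i_strictMono.lt_iff_lt.mp hs.2)⟩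
    rw [e'] at e
    omega
  · rintro ⟨hk, e⟩
    have e' := h.card_i_lt_add_card_j_lt hk.le
    have hb := h.le_two_mul_countBelow hk
    rw [countBelow_leftEnds] at hb
    -- the step after a return cannot go down, so `k` is a left end
    obtain ⟨t, ht⟩ : ∃ t, (D.i t : ℕ) = k := by
      by_contra! hne
      have : (Finset.univ.filter fun t => (D.i t : ℕ) < k + 1) =
          Finset.univ.filter fun t => (D.i t : ℕ) < k :=
        Finset.filter_congr fun t _ => by have := hne t; omega
      rw [this] at hb
      omega
    subst ht
    refine ⟨t, fun u hu => ?_, rfl⟩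
    have heq := Finset.eq_of_subset_of_card_le (hsub (D.i t)) (by omega)
    have hu' : u ∈ Finset.univ.filter fun s => (D.i s : ℕ) < D.i t := by
      simpa using D.i_strictMono hu
    rw [← heq] at hu'
    simpa using hu'

/-- The components correspond to the returns: both cut the path into the pieces between
consecutive visits of the starting level. -/
theorem leftEnds_mem_ballotSets : D.leftEnds ∈ ballotSets n D.m D.numComponents := by
  rw [mem_ballotSets]
  refine ⟨⟨D.leftEnds_subset, D.card_leftEnds⟩, fun k hk => h.le_two_mul_countBelow hk, ?_⟩
  rw [D.numComponents_eq, h.card_starts, Finset.card_filter, Finset.card_filter]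
  have e1 := Finset.sum_range_succ (fun k => if 2 * countBelow D.leftEnds k = k then 1 else 0) n
  have e2 := Finset.sum_range_succ' (fun k => if 2 * countBelow D.leftEnds k = k then 1 else 0) n
  rw [if_pos (by rw [countBelow_of_subset_range D.leftEnds_subset, card_leftEnds,
    h.two_mul_m])] at e1
  rw [if_pos (by simp [countBelow])] at e2
  omega

end IsPerfect

/-- The normal form with all `ε_t = δ_t = 1` whose left ends form a given ballot set: the `t`-th
smallest element of the set is paired with the `t`-th smallest element of its complement. -/
theorem exists_leftEnds_eq {r f : ℕ} {I : Finset ℕ} (hI : I ∈ ballotSets (2 * r) r f) :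
    ∃ D : NormalDatum (2 * r), D.IsPerfect ∧ (∀ t, D.ε t = true) ∧ D.leftEnds = I := by
  obtain ⟨⟨hsub, hcard⟩, hb, -⟩ := mem_ballotSets.mp hI
  let A : Finset (Fin (2 * r)) := Finset.univ.filter fun a => (a : ℕ) ∈ I
  have hAI : A.image Fin.val = I := by
    ext k
    simp only [A, Finset.mem_image, Finset.mem_filter, Finset.mem_univ, true_and]
    constructor
    · rintro ⟨a, ha, rfl⟩
      exact ha
    · intro hk
      exact ⟨⟨k, Finset.mem_range.mp (hsub hk)⟩, hk, rfl⟩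
  have hA : A.card = r := by
    rwa [← hAI, Finset.card_image_of_injective _ Fin.val_injective] at hcard
  have hA' : Aᶜ.card = r := by
    rw [Finset.card_compl, Fintype.card_fin, hA]
    omega
  let i := A.orderEmbOfFin hA
  let j := Aᶜ.orderEmbOfFin hA'
  have hi : ∀ t, i t ∈ A := fun t => Finset.orderEmbOfFin_mem _ _ _
  have hj : ∀ t, j t ∉ A := fun t => Finset.mem_compl.mp (Finset.orderEmbOfFin_mem _ _ _)
  have hij : ∀ s t, i s ≠ j t := fun s t e => hj t (e ▸ hi s)
  have hri : ∀ a ∈ A, ∃ t, a = i t := fun a ha => by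
    have : a ∈ Set.range i := by rw [Finset.range_orderEmbOfFin]; exact ha
    exact this.imp fun t ht => ht.symm
  have hrj : ∀ a, a ∉ A → ∃ t, a = j t := fun a ha => by
    have : a ∈ Set.range j := by
      rw [Finset.range_orderEmbOfFin]; exact Finset.mem_coe.mpr (Finset.mem_compl.mpr ha)
    exact this.imp fun t ht => ht.symm
  have hlt : ∀ t, i t < j t := by
    intro t
    by_contra hc
    have hji : j t < i t := lt_of_le_of_ne (not_lt.mp hc) (hij t t).symm
    -- up to the position of `j t` there are at most `t` up steps and at least `t + 1` down steps
    have hk : (j t : ℕ) + 1 ≤ 2 * r := (j t).isLt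
    have h1 := hb _ hk
    have h2 : countBelow I (j t + 1) ≤ t := by
      have : I.filter (· < (j t : ℕ) + 1) ⊆ (Finset.Iio t).image fun s => (i s : ℕ) := by
        intro k hk
        rw [Finset.mem_filter, ← hAI] at hk
        obtain ⟨hk, hkt⟩ := hk
        obtain ⟨a, ha, rfl⟩ := Finset.mem_image.mp hk
        obtain ⟨s, rfl⟩ := hri a ha
        refine Finset.mem_image.mpr ⟨s, Finset.mem_Iio.mpr ?_, rfl⟩
        rw [← i.lt_iff_lt]
        exact lt_of_le_of_lt (Nat.lt_succ_iff.mp hkt) hji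
      refine (Finset.card_le_card this).trans (Finset.card_image_le.trans ?_)
      simp
    have h3 : countBelow I (j t + 1) + ((t : ℕ) + 1) ≤ j t + 1 := by
      have hd : Disjoint (I.filter (· < (j t : ℕ) + 1))
          ((Finset.Iic t).image fun s => (j s : ℕ)) := by
        rw [Finset.disjoint_left]
        intro k hk hk'
        obtain ⟨s, -, rfl⟩ := Finset.mem_image.mp hk'
        exact hj s (Finset.mem_filter.mpr ⟨Finset.mem_univ _, (Finset.mem_filter.mp hk).1⟩)
      have hs : (I.filter (· < (j t : ℕ) + 1)) ∪ ((Finset.Iic t).image fun s => (j s : ℕ)) ⊆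
          Finset.range (j t + 1) := by
        refine Finset.union_subset (fun k hk => ?_) fun k hk => ?_
        · exact Finset.mem_range.mpr (Finset.mem_filter.mp hk).2
        · obtain ⟨s, hs, rfl⟩ := Finset.mem_image.mp hk
          exact Finset.mem_range.mpr
            (Nat.lt_succ_iff.mpr (j.monotone (Finset.mem_Iic.mp hs)))
      have hc := Finset.card_le_card hs
      rw [Finset.card_union_of_disjoint hd, Finset.card_range, Finset.card_image_of_injective (f := fun s => (j s : ℕ))
        _ (Fin.val_injective.comp j.injective), Fin.card_Iic] at hc
      exact hc
    omega
  refine ⟨⟨r, i, j, fun _ => true, fun _ => true, fun _ => Or.inl rfl, fun s t hst => ?_,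
    fun t => ?_, i.strictMono, fun t => (hlt t).le, fun _ _ h => by simp at h,
    fun s t _ h1 _ h3 => ?_⟩, ⟨fun _ => rfl, fun a => ?_⟩, fun _ => rfl, ?_⟩
  · simp [hst.symm, hij, (hij _ _).symm]
  · simp [(hij t t).symm]
  · exact absurd (j.strictMono (i.lt_iff_lt.mp h1)) h3.not_gt
  · by_cases ha : a ∈ A
    · obtain ⟨t, ht⟩ := hri a ha
      exact ⟨t, Or.inl ht⟩
    · obtain ⟨t, ht⟩ := hrj a ha
      exact ⟨t, Or.inr ht⟩
  · rw [← hAI, ← Finset.image_orderEmbOfFin_univ A hA, Finset.image_image]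
    rfl

end NormalDatum

/-! ### The bijection between forms and ballot paths -/

open Classical in
/-- The indices `a` such that `q` contains `x_a ^ 2`. -/
noncomputable def squareSupport {n : ℕ} {Ω : Type*} [Field Ω] (q : QuadraticForm Ω (Fin n → Ω)) :
    Finset ℕ :=
  (Finset.univ.filter fun a => q (Pi.single a 1) ≠ 0).image Fin.val

namespace NormalDatum.IsPerfect

variable {n : ℕ} {Ω : Type*} [Field Ω]

theorem squareSupport_toForm {D : NormalDatum n} (h : D.IsPerfect) (hε : ∀ t, D.ε t = true) :
    squareSupport (D.toForm Ω) = D.leftEnds := by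
  ext k
  simp only [squareSupport, leftEnds, Finset.mem_image, Finset.mem_filter, Finset.mem_univ,
    true_and]
  constructor
  · rintro ⟨a, ha, rfl⟩
    obtain ⟨t, rfl | rfl⟩ := h.covers a
    · exact ⟨t, rfl⟩
    · exact absurd (h.toForm_single_j t 1) ha
  · rintro ⟨t, rfl⟩
    exact ⟨D.i t, by simp [h.toForm_single_i, hε], rfl⟩

/-- The left ends determine the set of right ends as the complement, and both enumerations are
increasing. -/
theorem toForm_eq_of_leftEnds_eq {D D' : NormalDatum n} (h : D.IsPerfect) (h' : D'.IsPerfect)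
    (hε : ∀ t, D.ε t = true) (hε' : ∀ t, D'.ε t = true) (e : D.leftEnds = D'.leftEnds) :
    D.toForm Ω = D'.toForm Ω := by
  have hm : D.m = D'.m := by rw [← D.card_leftEnds, e, D'.card_leftEnds]
  have hcast : StrictMono (Fin.cast hm) := Fin.cast_strictMono hm
  have hsurj : Function.Surjective (Fin.cast hm) := (finCongr hm).surjective
  have hr : ∀ D : NormalDatum n, Set.range D.i = {a : Fin n | (a : ℕ) ∈ D.leftEnds} := fun D => by
    ext a
    simp [leftEnds, Fin.ext_iff]
  have hi : Set.range D.i = Set.range D'.i := by rw [hr, hr, e]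
  have hj : Set.range D.j = Set.range D'.j := by rw [h.range_j, h'.range_j, hi]
  refine toForm_eq_of_i_j_eq Ω hm (congrFun ?_) (congrFun ?_) (fun t => by rw [hε, hε'])
    (fun t => by rw [h.δ_eq, h'.δ_eq])
  · refine (StrictMono.range_inj D.i_strictMono (D'.i_strictMono.comp hcast)).mp ?_
    rw [hi, hsurj.range_comp]
  · refine (StrictMono.range_inj (h.j_strictMono hε) ((h'.j_strictMono hε').comp hcast)).mp ?_
    rw [hj, hsurj.range_comp]

end NormalDatum.IsPerfect

/-- The forms to be counted are those of the perfect normal data with all `ε_t = 1`, that is, with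
no nested pairs. -/
theorem mem_maximalNormalForms_iff {Ω : Type*} [Field Ω] [CharP Ω 2] [Infinite Ω] {r f : ℕ}
    {q : QuadraticForm Ω (Fin (2 * r) → Ω)} :
    q ∈ maximalNormalForms Ω r f ↔ ∃ D : NormalDatum (2 * r), D.IsPerfect ∧
      (∀ t, D.ε t = true) ∧ D.numComponents = f ∧ D.toForm Ω = q := by
  constructor
  · rintro ⟨hrad, hrank, D, rfl, hf⟩
    have h := D.isPerfect_of_radical_eq_bot Ω hrad
    exact ⟨D, h, h.bRank_eq_iff.mp hrank, by exact_mod_cast hf, rfl⟩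
  · rintro ⟨D, h, hε, rfl, rfl⟩
    exact ⟨h.radical_eq_bot, h.bRank_eq_iff.mpr hε, D, rfl, rfl⟩

theorem bijOn_squareSupport (Ω : Type*) [Field Ω] [CharP Ω 2] [Infinite Ω] (r f : ℕ) :
    Set.BijOn squareSupport (maximalNormalForms Ω r f)
      (ballotSets (2 * r) r f : Set (Finset ℕ)) := by
  have hm : ∀ {D : NormalDatum (2 * r)}, D.IsPerfect → D.m = r := fun h => by
    have := h.two_mul_m
    omega
  refine ⟨fun q hq => ?_, fun q hq q' hq' e => ?_, fun I hI => ?_⟩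
  · obtain ⟨D, h, hε, rfl, rfl⟩ := mem_maximalNormalForms_iff.mp hq
    rw [h.squareSupport_toForm hε]
    have := h.leftEnds_mem_ballotSets
    rwa [hm h] at this
  · obtain ⟨D, h, hε, -, rfl⟩ := mem_maximalNormalForms_iff.mp hq
    obtain ⟨D', h', hε', -, rfl⟩ := mem_maximalNormalForms_iff.mp hq'
    rw [h.squareSupport_toForm hε, h'.squareSupport_toForm hε'] at e
    exact h.toForm_eq_of_leftEnds_eq h' hε hε' e
  · obtain ⟨D, h, hε, rfl⟩ := NormalDatum.exists_leftEnds_eq hI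
    refine ⟨D.toForm Ω, mem_maximalNormalForms_iff.mpr ⟨D, h, hε, ?_, rfl⟩,
      h.squareSupport_toForm hε⟩
    have := h.leftEnds_mem_ballotSets
    rw [← (mem_ballotSets.mp this).2.2]
    exact (mem_ballotSets.mp hI).2.2

theorem mainTheorem3 (Ω : Type*) [Field Ω] [CharP Ω 2] (hΩ : IsQuadraticallyClosed Ω)
    (r : ℕ) (hr : 1 ≤ r) (f : ℤ) :
    (maximalNormalForms Ω r f).encard = (catalanTriangle ((r : ℤ) - 1) ((r : ℤ) - f) : ℕ∞) := by
  have := hΩ.infinite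
  obtain ⟨u, rfl⟩ := Nat.exists_eq_add_of_le' hr
  rcases lt_or_ge f 0 with hf | hf
  · have he : maximalNormalForms Ω (u + 1) f = ∅ := by
      rw [Set.eq_empty_iff_forall_notMem]
      rintro q ⟨-, -, D, -, hD⟩
      omega
    rw [he, Set.encard_empty, catalanTriangle, if_neg (by omega), Nat.cast_zero]
  · lift f to ℕ using hf
    have hb := bijOn_squareSupport Ω (u + 1) f
    rw [← hb.injOn.encard_image, hb.image_eq, Set.encard_coe_eq_coe_finsetCard,
      card_ballotSets f (by ring : 2 * (u + 1) = u + 1 + (u + 1)) le_rfl, catalanTriangle]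
    congr 1
    split_ifs with h1 h2 h2
    · congr 1 <;> omega
    · exact catalanTriangleNat_eq_zero_of_lt (by omega)
    · omega
    · rfl
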